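/- For a Borel measure $\mu$ on $\mathbb{R}^2$, $x\in\mathbb{R}^2$ and $r>0$ put $$\beta_{\mu;2}^{1}(x,r)=\Bigl(\inf_{L}\int_{B_r(x)}\Bigl(\frac{\operatorname{dist}(y,L)}{r}\Bigr)^{2}\,\frac{d\mu(y)}{r}\Bigr)^{1/2}\in[0,\infty],$$ where $L$ runs over all (affine) lines in $\mathbb{R}^2$ and $B_r(x)$ is the open Euclidean ball. A set $K\subset\mathbb{R}^2$ is called a rectifiable curve (of finite length) if it is the image of a continuous map $\gamma:[0,1]\to\mathbb{R}^2$ of finite length (total variation). **Theorem.** There is a rectifiable curve of finite length $K_0\subset\mathbb{R}^2$ (in particular a connected set, equal to its closure) with $0<\mathcal H^1(K_0)<\infty$, such that for $\mu=\mathcal H^1\restriction K_0$, every $x\in K_0$ and every $\delta>0$, $$\int_{B_\delta(x)}\int_0^\delta\beta_{\mu;2}^1(y,r)^2\,\frac{dr}{r}\,d\mu(y)=\infty .$$ -/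

import Mathlib

open MeasureTheory Set Metric
open scoped ENNReal

noncomputable section

/-- The Jones number `β^n_{μ;p}(x, r)` of a measure `μ`, as an extended nonnegative real: the infimum
runs over all affine `n`-planes `L`, and balls are open. -/
def jonesBeta {d : ℕ} (μ : Measure (EuclideanSpace ℝ (Fin d))) (n : ℕ) (p : ℝ)
    (x : EuclideanSpace ℝ (Fin d)) (r : ℝ) : ℝ≥0∞ :=
  (⨅ (L : AffineSubspace ℝ (EuclideanSpace ℝ (Fin d)))
      (_ : (L : Set (EuclideanSpace ℝ (Fin d))).Nonempty ∧ Module.finrank ℝ L.direction = n),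
    ∫⁻ y in ball x r,
      ENNReal.ofReal ((infDist y (L : Set (EuclideanSpace ℝ (Fin d))) / r) ^ p / r ^ n) ∂μ) ^ (1 / p)

/-- The local Carleson integral
`C^n_{μ;p}(x, R) = ∫_{B(x,R)} ∫_0^R β^n_{μ;p}(y, r)² dr/r dμ(y)`. -/
def carlesonIntegral {d : ℕ} (μ : Measure (EuclideanSpace ℝ (Fin d))) (n : ℕ) (p : ℝ)
    (x : EuclideanSpace ℝ (Fin d)) (R : ℝ) : ℝ≥0∞ :=
  ∫⁻ y in ball x R, (∫⁻ r in Ioo (0 : ℝ) R, jonesBeta μ n p y r ^ 2 / ENNReal.ofReal r) ∂μ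

/-- A rectifiable curve: the image of `[0, 1]` under a continuous map of finite length. -/
def IsRectifiableCurve {d : ℕ} (K : Set (EuclideanSpace ℝ (Fin d))) : Prop :=
  ∃ γ : ℝ → EuclideanSpace ℝ (Fin d),
    ContinuousOn γ (Icc 0 1) ∧ eVariationOn γ (Icc 0 1) < ∞ ∧ γ '' Icc 0 1 = K

end

/-!
The curve is the graph over `[0, 1]` of a continuous function `f = ∑ k, w k` of bounded variation.
The term `w k` is a comb: on a short interval of length `2 * ρ` it oscillates `2 * M` times with
amplitude `ρ`, and it is constant elsewhere. Its variation is comparable to `M * ρ`, which is chosen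
to be `2 ^ (-k)`, so that `f` has bounded variation and its graph has finite length
(`add_abs_combSeries_sub_le`, `exists_lipschitzOnWith_comp_eq`).

The graph over such an interval has length at least `M * ρ` inside a set of diameter comparable
to `ρ`, and a fixed proportion of it stays away from every line, since it contains teeth that are
nearly vertical and teeth at horizontal distance `ρ` from each other
(`IsComb.ofReal_le_tooth_add_tooth`). Hence `β ^ 2` is at least of order `M` at all points over the
interval and all scales comparable to `ρ`, and the Carleson integral near the comb is at least of
order `M ^ 2 * ρ = 2 ^ (-k) * M` (`IsComb.ofReal_le_carlesonIntegral`). The number `M` is free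
while `M * ρ = 2 ^ (-k)` is fixed, so this can be made as large as `2 ^ k`.

The earlier combs tilt the `k`-th one by a slope comparable to `A k = 1 + ∑ j < k, M j`, which costs
the power `A ^ 6`; the choice `M k = 1000 * 4 ^ k * A k ^ 7` absorbs it. The later combs are so low
that they do not matter (`abs_combSeries_sub_sub_combWave_sub_le`). As the combs sit at the points
of a dense sequence, each ball around a point of the graph contains combs of arbitrarily high index
(`carlesonIntegral_combSeries_eq_top`), and the integral over it is infinite.
-/

/-! ### Length of pieces of a graph -/

/-- The parametrization `t ↦ (t, f t)` of the graph of `f`. -/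
def graphMap (f : ℝ → ℝ) (t : ℝ) : EuclideanSpace ℝ (Fin 2) := !₂[t, f t]

@[simp] lemma graphMap_zero (f : ℝ → ℝ) (t : ℝ) : graphMap f t 0 = t := rfl

@[simp] lemma graphMap_one (f : ℝ → ℝ) (t : ℝ) : graphMap f t 1 = f t := rfl

lemma graphMap_injective (f : ℝ → ℝ) : Function.Injective (graphMap f) := fun s t h => by
  simpa using congrArg (fun z : EuclideanSpace ℝ (Fin 2) => z 0) h

lemma continuous_graphMap {f : ℝ → ℝ} (hf : Continuous f) : Continuous (graphMap f) := by
  refine (PiLp.continuous_toLp 2 _).comp (continuous_pi fun i => ?_)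
  fin_cases i
  · exact continuous_id
  · exact hf

lemma abs_sub_apply_le_dist (x y : EuclideanSpace ℝ (Fin 2)) (i : Fin 2) :
    |x i - y i| ≤ dist x y := by
  rw [dist_eq_norm]
  exact PiLp.norm_apply_le (x - y) i

lemma dist_graphMap_le (f : ℝ → ℝ) (s t : ℝ) :
    dist (graphMap f s) (graphMap f t) ≤ |s - t| + |f s - f t| := by
  rw [EuclideanSpace.dist_eq, Fin.sum_univ_two]
  simp only [graphMap_zero, graphMap_one, Real.dist_eq]
  refine Real.sqrt_le_iff.2 ⟨by positivity, ?_⟩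
  nlinarith [abs_nonneg (s - t), abs_nonneg (f s - f t)]

lemma measurableSet_graphMap_image {f : ℝ → ℝ} (hf : Continuous f) (s t : ℝ) :
    MeasurableSet (graphMap f '' Icc s t) :=
  (isCompact_Icc.image (continuous_graphMap hf)).measurableSet

lemma lipschitzWith_apply (i : Fin 2) :
    LipschitzWith 1 (fun z : EuclideanSpace ℝ (Fin 2) => z i) :=
  LipschitzWith.of_dist_le_mul fun x y => by
    simpa [Real.dist_eq] using abs_sub_apply_le_dist x y i

/-- A set whose image under a `1`-Lipschitz function covers an interval has at least the length of
that interval. -/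
lemma ofReal_abs_sub_le_hausdorffMeasure {g : EuclideanSpace ℝ (Fin 2) → ℝ}
    (hg : LipschitzWith 1 g) {S : Set (EuclideanSpace ℝ (Fin 2))} {a b : ℝ}
    (h : uIcc a b ⊆ g '' S) : ENNReal.ofReal |b - a| ≤ μH[1] S := by
  calc ENNReal.ofReal |b - a| = μH[1] (uIcc a b) := by
        rw [hausdorffMeasure_real, Real.volume_interval]
    _ ≤ μH[1] (g '' S) := measure_mono h
    _ ≤ μH[1] S := by simpa using hg.hausdorffMeasure_image_le zero_le_one S

lemma ofReal_abs_sub_le_hausdorffMeasure_graphMap {f : ℝ → ℝ} (hf : Continuous f) {s t : ℝ}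
    (hst : s ≤ t) : ENNReal.ofReal |f t - f s| ≤ μH[1] (graphMap f '' Icc s t) := by
  refine ofReal_abs_sub_le_hausdorffMeasure (lipschitzWith_apply 1) ?_
  rw [image_image]
  simpa [uIcc_of_le hst] using intermediate_value_uIcc (hf.continuousOn (s := uIcc s t))

/-- Over an interval on which `f` oscillates by at least `D`, if a nonnegative `1`-Lipschitz
function `g` reaches `D` on the graph, then `g ≥ D / 2` on a part of the graph of length at least
`D / 2`. -/
lemma ofReal_le_lintegral_graphMap {f : ℝ → ℝ} (hf : Continuous f) {s t τ D : ℝ}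
    {g : EuclideanSpace ℝ (Fin 2) → ℝ} (hg : LipschitzWith 1 g) (hτ : τ ∈ Icc s t)
    (hD : 0 ≤ D) (hgD : D ≤ g (graphMap f τ)) (hfD : D ≤ |f t - f s|) :
    ENNReal.ofReal ((D / 2) ^ 3) ≤
      ∫⁻ z in graphMap f '' Icc s t, ENNReal.ofReal (g z ^ 2) ∂μH[1] := by
  have hst : s ≤ t := hτ.1.trans hτ.2
  have hγ := continuous_graphMap hf
  set T := graphMap f '' Icc s t ∩ {z | D / 2 ≤ g z} with hT
  have hTm : MeasurableSet T :=
    (measurableSet_graphMap_image hf s t).inter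
      (isClosed_le continuous_const hg.continuous).measurableSet
  have hμ : ENNReal.ofReal (D / 2) ≤ μH[1] T := by
    by_cases h : ∀ σ ∈ Icc s t, D / 2 ≤ g (graphMap f σ)
    · have : graphMap f '' Icc s t ⊆ T := by
        rintro _ ⟨σ, hσ, rfl⟩
        exact ⟨mem_image_of_mem _ hσ, h σ hσ⟩
      exact (ENNReal.ofReal_le_ofReal (by linarith)).trans
        ((ofReal_abs_sub_le_hausdorffMeasure_graphMap hf hst).trans (measure_mono this))
    · push Not at h
      obtain ⟨σ, hσ, hσD⟩ := h
      have key : uIcc (D / 2) D ⊆ g '' T := by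
        rw [uIcc_of_le (by linarith)]
        intro y hy
        have hc : ContinuousOn (fun u => g (graphMap f u)) (uIcc σ τ) :=
          (hg.continuous.comp hγ).continuousOn
        have hy' : y ∈ uIcc (g (graphMap f σ)) (g (graphMap f τ)) :=
          Icc_subset_uIcc ⟨by linarith [hy.1], by linarith [hy.2]⟩
        obtain ⟨u, hu, rfl⟩ := intermediate_value_uIcc hc hy'
        exact ⟨graphMap f u, ⟨mem_image_of_mem _ (uIcc_subset_Icc hσ hτ hu), hy.1⟩, rfl⟩
      have := ofReal_abs_sub_le_hausdorffMeasure hg key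
      rwa [abs_of_nonneg (by linarith), show D - D / 2 = D / 2 by ring] at this
  calc ENNReal.ofReal ((D / 2) ^ 3)
      = ENNReal.ofReal ((D / 2) ^ 2) * ENNReal.ofReal (D / 2) := by
        rw [← ENNReal.ofReal_mul (by positivity)]; ring_nf
    _ ≤ ENNReal.ofReal ((D / 2) ^ 2) * μH[1] T := by gcongr
    _ = ∫⁻ _ in T, ENNReal.ofReal ((D / 2) ^ 2) ∂μH[1] := (setLIntegral_const _ _).symm
    _ ≤ ∫⁻ z in T, ENNReal.ofReal (g z ^ 2) ∂μH[1] :=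
        setLIntegral_mono' hTm fun z hz => by
          have : D / 2 ≤ g z := hz.2
          gcongr
    _ ≤ _ := lintegral_mono_set inter_subset_left

/-! ### Distances to a line -/

/-- A unit normal `(u, v)` of a line gives a linear functional that is constant on the line and
`1`-Lipschitz. -/
lemma exists_unit_normal (L : AffineSubspace ℝ (EuclideanSpace ℝ (Fin 2)))
    (hne : (L : Set (EuclideanSpace ℝ (Fin 2))).Nonempty)
    (hL : Module.finrank ℝ L.direction = 1) :
    ∃ u v : ℝ, u ^ 2 + v ^ 2 = 1 ∧ ∀ z w : EuclideanSpace ℝ (Fin 2),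
      |u * (z 0 - w 0) + v * (z 1 - w 1)| ≤ infDist z L + infDist w L := by
  have hbot : L.directionᗮ ≠ ⊥ := by
    intro h
    rw [Submodule.orthogonal_eq_bot_iff] at h
    rw [h, finrank_top] at hL
    simp at hL
  obtain ⟨m, hm, hm0⟩ := Submodule.exists_mem_ne_zero_of_ne_bot hbot
  obtain ⟨p, hp⟩ := hne
  set n := (‖m‖⁻¹ : ℝ) • m with hn
  have hnmem : n ∈ L.directionᗮ := Submodule.smul_mem _ _ hm
  have hn1 : ‖n‖ = 1 := norm_smul_inv_norm hm0
  have hdist (z : EuclideanSpace ℝ (Fin 2)) : |inner ℝ n (z - p)| ≤ infDist z L := by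
    refine (le_infDist ⟨p, hp⟩).2 fun w hw => ?_
    have h0 : inner ℝ n (w - p) = 0 := by
      rw [real_inner_comm]
      exact hnmem _ (AffineSubspace.vsub_mem_direction hw hp)
    have : inner ℝ n (z - p) = inner ℝ n (z - w) := by
      rw [← sub_add_sub_cancel z w p, inner_add_right, h0, add_zero]
    rw [this, dist_eq_norm]
    simpa [hn1] using abs_real_inner_le_norm n (z - w)
  refine ⟨n 0, n 1, ?_, fun z w => ?_⟩
  · have := EuclideanSpace.real_norm_sq_eq n
    rw [hn1, Fin.sum_univ_two] at this
    linarith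
  · have : n 0 * (z 0 - w 0) + n 1 * (z 1 - w 1) = inner ℝ n (z - p) - inner ℝ n (w - p) := by
      simp only [PiLp.inner_apply, Fin.sum_univ_two, PiLp.sub_apply, RCLike.inner_apply,
        conj_trivial]
      ring
    rw [this]
    exact (abs_sub _ _).trans (add_le_add (hdist z) (hdist w))

/-- Three graph points, the first two almost vertically above each other at height at least `ρ`,
the third at horizontal distance `ρ`, are not all close to one line. -/
lemma exists_le_infDist_of_three_points {f : ℝ → ℝ} {s e s' ρ A : ℝ} (hρ : 0 < ρ) (hA : 1 ≤ A)
    (hse : |e - s| ≤ ρ / (8 * A)) (hfe : ρ ≤ |f e - f s|) (hss : s' - s = ρ)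
    (hfs : |f s' - f s| ≤ A * ρ) (L : AffineSubspace ℝ (EuclideanSpace ℝ (Fin 2)))
    (hne : (L : Set (EuclideanSpace ℝ (Fin 2))).Nonempty)
    (hL : Module.finrank ℝ L.direction = 1) :
    ρ / (8 * A) ≤ infDist (graphMap f s) L ∨ ρ / (8 * A) ≤ infDist (graphMap f e) L ∨
      ρ / (8 * A) ≤ infDist (graphMap f s') L := by
  obtain ⟨u, v, huv, h⟩ := exists_unit_normal L hne hL
  by_contra! hc
  obtain ⟨h1, h2, h3⟩ := hc
  set κ := ρ / (8 * A) with hκ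
  have hκA : κ * A = ρ / 8 := by rw [hκ]; field_simp
  have hκ0 : 0 < κ := by positivity
  have hκρ : κ ≤ ρ / 8 := by nlinarith
  have hu : |u| ≤ 1 := abs_le_one_iff_mul_self_le_one.2 (by nlinarith [sq_nonneg v])
  have e1 := h (graphMap f e) (graphMap f s)
  have e2 := h (graphMap f s') (graphMap f s)
  simp only [graphMap_zero, graphMap_one] at e1 e2
  have a1 : |v| * |f e - f s| ≤ 3 * κ := by
    calc |v| * |f e - f s|
        = |(u * (e - s) + v * (f e - f s)) - u * (e - s)| := by rw [← abs_mul]; ring_nf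
      _ ≤ |u * (e - s) + v * (f e - f s)| + |u| * |e - s| := by
          rw [← abs_mul]; exact abs_sub _ _
      _ ≤ 2 * κ + 1 * κ := by
          gcongr
          linarith
      _ = 3 * κ := by ring
  have a2 : |v| * ρ ≤ 3 * κ := (mul_le_mul_of_nonneg_left hfe (abs_nonneg v)).trans a1
  have a3 : |u| * ρ ≤ 2 * κ + |v| * (A * ρ) := by
    calc |u| * ρ = |(u * (s' - s) + v * (f s' - f s)) - v * (f s' - f s)| := by
          rw [add_sub_cancel_right, abs_mul, hss, abs_of_pos hρ]
      _ ≤ |u * (s' - s) + v * (f s' - f s)| + |v| * |f s' - f s| := by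
          rw [← abs_mul]; exact abs_sub _ _
      _ ≤ 2 * κ + |v| * (A * ρ) := by
          gcongr
          linarith
  have a4 : |v| ≤ 3 / 8 := by nlinarith
  have a5 : |u| ≤ 5 / 8 := by nlinarith [mul_le_mul_of_nonneg_left a2 (zero_le_one.trans hA)]
  nlinarith [sq_abs u, sq_abs v, abs_nonneg u, abs_nonneg v]

/-! ### The Carleson integral near a comb -/

/-- The function `f` has a comb with `2 * M` teeth on `[a, a + 2 * ρ]`: on the `i`-th tooth, which
is the interval `[a + 2 * i * σ, a + (2 * i + 1) * σ]` with `σ = ρ / (2 * M)`, the values of `f` at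
the endpoints differ by at least `ρ`, and the total oscillation of `f` is at most `A * ρ`. -/
structure IsComb (f : ℝ → ℝ) (a ρ : ℝ) (M : ℕ) (A : ℝ) : Prop where
  pos : 0 < ρ
  one_le : 1 ≤ A
  le_teeth : 4 * A ≤ M
  le_abs_sub : ∀ i < 2 * M,
    ρ ≤ |f (a + (2 * i + 1) * (ρ / (2 * M))) - f (a + 2 * i * (ρ / (2 * M)))|
  abs_sub_le : ∀ s ∈ Icc a (a + 2 * ρ), ∀ t ∈ Icc a (a + 2 * ρ), |f s - f t| ≤ A * ρ

/-- The graph of `f` over the `i`-th tooth of a comb. -/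
def combTooth (f : ℝ → ℝ) (a ρ : ℝ) (M i : ℕ) : Set (EuclideanSpace ℝ (Fin 2)) :=
  graphMap f '' Icc (a + 2 * i * (ρ / (2 * M))) (a + (2 * i + 1) * (ρ / (2 * M)))

namespace IsComb

variable {f : ℝ → ℝ} {a ρ A : ℝ} {M : ℕ}

lemma teeth_pos (h : IsComb f a ρ M A) : (0 : ℝ) < M := by
  linarith [h.one_le, h.le_teeth]

lemma width_pos (h : IsComb f a ρ M A) : 0 < ρ / (2 * M) :=
  div_pos h.pos (by linarith [h.teeth_pos])

lemma width_mul (h : IsComb f a ρ M A) : 2 * M * (ρ / (2 * M)) = ρ := by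
  have := h.teeth_pos
  field_simp

lemma interval_subset (h : IsComb f a ρ M A) {i : ℕ} (hi : i < 2 * M) :
    Icc (a + 2 * i * (ρ / (2 * M))) (a + (2 * i + 1) * (ρ / (2 * M))) ⊆ Icc a (a + 2 * ρ) := by
  have h1 := h.width_pos
  have h2 := h.width_mul
  set σ := ρ / (2 * M)
  have hi' : (i : ℝ) + 1 ≤ 2 * M := by exact_mod_cast hi
  refine Icc_subset_Icc ?_ ?_
  · have : 0 ≤ 2 * (i : ℝ) * σ := by positivity
    linarith
  · nlinarith

lemma tooth_subset (h : IsComb f a ρ M A) {i : ℕ} (hi : i < 2 * M) :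
    combTooth f a ρ M i ⊆ graphMap f '' Icc a (a + 2 * ρ) :=
  image_mono (h.interval_subset hi)

lemma pairwiseDisjoint_tooth (h : IsComb f a ρ M A) (S : Set ℕ) :
    S.PairwiseDisjoint (combTooth f a ρ M) := by
  have key : ∀ i j : ℕ, i < j → Disjoint (combTooth f a ρ M i) (combTooth f a ρ M j) := by
    intro i j hij
    refine (disjoint_image_iff (graphMap_injective f)).2 ?_
    rw [Set.disjoint_left]
    intro x hx hx'
    have hij' : (i : ℝ) + 1 ≤ j := by exact_mod_cast hij
    nlinarith [h.width_pos, hx.2, hx'.1]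
  intro i _ j _ hij
  rcases lt_or_gt_of_ne hij with h' | h'
  · exact key i j h'
  · exact (key j i h').symm

lemma sum_tooth_le (h : IsComb f a ρ M A) (hf : Continuous f)
    (F : EuclideanSpace ℝ (Fin 2) → ℝ≥0∞) :
    ∑ i ∈ Finset.range (2 * M), ∫⁻ z in combTooth f a ρ M i, F z ∂μH[1] ≤
      ∫⁻ z in graphMap f '' Icc a (a + 2 * ρ), F z ∂μH[1] := by
  rw [← lintegral_biUnion_finset (h.pairwiseDisjoint_tooth _)
    fun i _ => measurableSet_graphMap_image hf _ _]
  exact lintegral_mono_set (iUnion₂_subset fun i hi => h.tooth_subset (Finset.mem_range.1 hi))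

lemma ofReal_le_hausdorffMeasure (h : IsComb f a ρ M A) (hf : Continuous f) :
    ENNReal.ofReal (M * ρ) ≤ μH[1] (graphMap f '' Icc a (a + 2 * ρ)) := by
  have h1 := h.sum_tooth_le hf 1
  simp only [Pi.one_apply, lintegral_one, Measure.restrict_apply MeasurableSet.univ,
    univ_inter] at h1
  refine le_trans ?_ h1
  have h2 : ∀ i ∈ Finset.range (2 * M), ENNReal.ofReal ρ ≤ μH[1] (combTooth f a ρ M i) := by
    intro i hi
    refine (ENNReal.ofReal_le_ofReal (h.le_abs_sub i (Finset.mem_range.1 hi))).trans ?_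
    exact ofReal_abs_sub_le_hausdorffMeasure_graphMap hf (by linarith [h.width_pos])
  refine le_trans ?_ (Finset.sum_le_sum h2)
  rw [Finset.sum_const, Finset.card_range, nsmul_eq_mul, ← ENNReal.ofReal_natCast,
    ← ENNReal.ofReal_mul (by positivity)]
  refine ENNReal.ofReal_le_ofReal ?_
  push_cast
  nlinarith [h.pos, h.teeth_pos]

/-- The two teeth `i` and `i + M` of a comb are at horizontal distance `ρ`, so a fixed proportion
of their length stays away from a given line. -/
lemma ofReal_le_tooth_add_tooth (h : IsComb f a ρ M A) (hf : Continuous f)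
    (L : AffineSubspace ℝ (EuclideanSpace ℝ (Fin 2)))
    (hne : (L : Set (EuclideanSpace ℝ (Fin 2))).Nonempty)
    (hL : Module.finrank ℝ L.direction = 1) {i : ℕ} (hi : i < M) :
    ENNReal.ofReal ((ρ / (16 * A)) ^ 3) ≤
      (∫⁻ z in combTooth f a ρ M i, ENNReal.ofReal (infDist z L ^ 2) ∂μH[1]) +
        ∫⁻ z in combTooth f a ρ M (M + i), ENNReal.ofReal (infDist z L ^ 2) ∂μH[1] := by
  have hA0 : 0 < A := by linarith [h.one_le]
  have hσ := h.width_pos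
  have hi1 : i < 2 * M := by omega
  have hi2 : M + i < 2 * M := by omega
  have hM := h.teeth_pos
  have hρ := h.pos
  have hD : ρ / (8 * A) ≤ ρ := div_le_self h.pos.le (by linarith [h.one_le])
  have htooth {j : ℕ} (hj : j < 2 * M) {τ : ℝ}
      (hτ : τ ∈ Icc (a + 2 * j * (ρ / (2 * M))) (a + (2 * j + 1) * (ρ / (2 * M))))
      (hτL : ρ / (8 * A) ≤ infDist (graphMap f τ) L) :
      ENNReal.ofReal ((ρ / (16 * A)) ^ 3) ≤
        ∫⁻ z in combTooth f a ρ M j, ENNReal.ofReal (infDist z L ^ 2) ∂μH[1] := by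
    have := ofReal_le_lintegral_graphMap hf
      (lipschitz_infDist_pt (L : Set (EuclideanSpace ℝ (Fin 2)))) hτ
      (div_pos hρ (by positivity : 0 < 8 * A)).le hτL (hD.trans (h.le_abs_sub j hj))
    rwa [show ρ / (8 * A) / 2 = ρ / (16 * A) by field_simp; norm_num] at this
  have hmem (j : ℕ) : a + 2 * j * (ρ / (2 * M)) ∈
      Icc (a + 2 * j * (ρ / (2 * M))) (a + (2 * j + 1) * (ρ / (2 * M))) :=
    ⟨le_rfl, by linarith⟩
  have hmem' (j : ℕ) : a + (2 * j + 1) * (ρ / (2 * M)) ∈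
      Icc (a + 2 * j * (ρ / (2 * M))) (a + (2 * j + 1) * (ρ / (2 * M))) :=
    ⟨by linarith, le_rfl⟩
  have hwidth : |a + (2 * i + 1) * (ρ / (2 * M)) - (a + 2 * i * (ρ / (2 * M)))|
      ≤ ρ / (8 * A) := by
    rw [show a + (2 * i + 1) * (ρ / (2 * M)) - (a + 2 * i * (ρ / (2 * M))) = ρ / (2 * M) by ring,
      abs_of_pos hσ]
    exact div_le_div_of_nonneg_left hρ.le (by positivity) (by linarith [h.le_teeth])
  have hshift : a + 2 * (M + i : ℕ) * (ρ / (2 * M)) - (a + 2 * i * (ρ / (2 * M))) = ρ := by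
    have := h.width_mul
    push_cast
    linarith
  have hosc : |f (a + 2 * (M + i : ℕ) * (ρ / (2 * M))) - f (a + 2 * i * (ρ / (2 * M)))|
      ≤ A * ρ :=
    h.abs_sub_le _ (h.interval_subset hi2 (hmem _)) _ (h.interval_subset hi1 (hmem _))
  rcases exists_le_infDist_of_three_points hρ h.one_le hwidth (h.le_abs_sub i hi1) hshift hosc
    L hne hL with h' | h' | h'
  · exact (htooth hi1 (hmem i) h').trans le_self_add
  · exact (htooth hi1 (hmem' i) h').trans le_self_add
  · exact (htooth hi2 (hmem (M + i)) h').trans le_add_self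

lemma ofReal_le_lintegral_infDist (h : IsComb f a ρ M A) (hf : Continuous f)
    (L : AffineSubspace ℝ (EuclideanSpace ℝ (Fin 2)))
    (hne : (L : Set (EuclideanSpace ℝ (Fin 2))).Nonempty)
    (hL : Module.finrank ℝ L.direction = 1) :
    ENNReal.ofReal (M * (ρ / (16 * A)) ^ 3) ≤
      ∫⁻ z in graphMap f '' Icc a (a + 2 * ρ), ENNReal.ofReal (infDist z L ^ 2) ∂μH[1] := by
  refine le_trans ?_ (h.sum_tooth_le hf _)
  rw [two_mul, Finset.sum_range_add, ← Finset.sum_add_distrib]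
  refine le_trans ?_ (Finset.sum_le_sum fun i hi =>
    h.ofReal_le_tooth_add_tooth hf L hne hL (Finset.mem_range.1 hi))
  rw [Finset.sum_const, Finset.card_range, nsmul_eq_mul, ← ENNReal.ofReal_natCast,
    ← ENNReal.ofReal_mul (by positivity)]

lemma dist_lt (h : IsComb f a ρ M A) {y z : EuclideanSpace ℝ (Fin 2)}
    (hy : y ∈ graphMap f '' Icc a (a + 2 * ρ)) (hz : z ∈ graphMap f '' Icc a (a + 2 * ρ)) :
    dist z y < 4 * A * ρ := by
  obtain ⟨s, hs, rfl⟩ := hy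
  obtain ⟨t, ht, rfl⟩ := hz
  have h1 := dist_graphMap_le f t s
  have h2 := h.abs_sub_le t ht s hs
  have h3 : |t - s| ≤ 2 * ρ := abs_le.2 ⟨by linarith [hs.2, ht.1], by linarith [hs.1, ht.2]⟩
  nlinarith [h.one_le, h.pos]

lemma ofReal_le_jonesBeta_sq (h : IsComb f a ρ M A) (hf : Continuous f)
    {K : Set (EuclideanSpace ℝ (Fin 2))} (hK : graphMap f '' Icc a (a + 2 * ρ) ⊆ K)
    {y : EuclideanSpace ℝ (Fin 2)} (hy : y ∈ graphMap f '' Icc a (a + 2 * ρ)) {r : ℝ}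
    (hr : 4 * A * ρ ≤ r) :
    ENNReal.ofReal (M * (ρ / (16 * A)) ^ 3 / r ^ 3) ≤
      jonesBeta (μH[1].restrict K) 1 2 y r ^ 2 := by
  have hr0 : 0 < r := by
    have := h.pos
    have := h.one_le
    exact lt_of_lt_of_le (by positivity) hr
  unfold jonesBeta
  -- The outer square cancels the square root, which leaves the infimum over lines.
  rw [← ENNReal.rpow_natCast, ← ENNReal.rpow_mul,
    show (1 / (2 : ℝ)) * ((2 : ℕ) : ℝ) = 1 by norm_num, ENNReal.rpow_one]
  refine le_iInf₂ fun L hL => ?_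
  have hsub : graphMap f '' Icc a (a + 2 * ρ) ⊆ ball y r ∩ K :=
    fun z hz => ⟨mem_ball.2 ((h.dist_lt hy hz).trans_le hr), hK hz⟩
  rw [Measure.restrict_restrict measurableSet_ball]
  refine le_trans ?_ (lintegral_mono_set hsub)
  have heq : ∀ z : EuclideanSpace ℝ (Fin 2),
      ENNReal.ofReal ((infDist z (L : Set (EuclideanSpace ℝ (Fin 2))) / r) ^ (2 : ℝ) / r ^ 1) =
        ENNReal.ofReal (1 / r ^ 3) * ENNReal.ofReal (infDist z L ^ 2) := by
    intro z
    rw [← ENNReal.ofReal_mul (by positivity), Real.rpow_two]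
    congr 1
    field_simp
  simp_rw [heq]
  rw [lintegral_const_mul' _ _ ENNReal.ofReal_ne_top, div_eq_mul_one_div, mul_comm,
    ENNReal.ofReal_mul (by positivity)]
  gcongr
  exact h.ofReal_le_lintegral_infDist hf L hL.1 hL.2

/-- A comb with many teeth forces a large Carleson integral: the scales `r` between `4 * A * ρ` and
`8 * A * ρ` see the whole comb, whose length is at least `M * ρ`. -/
lemma ofReal_le_carlesonIntegral (h : IsComb f a ρ M A) (hf : Continuous f)
    {K : Set (EuclideanSpace ℝ (Fin 2))} (hK : graphMap f '' Icc a (a + 2 * ρ) ⊆ K)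
    {x : EuclideanSpace ℝ (Fin 2)} {δ : ℝ} (hx : graphMap f '' Icc a (a + 2 * ρ) ⊆ ball x δ)
    (hδ : 8 * A * ρ ≤ δ) :
    ENNReal.ofReal (M ^ 2 * ρ / (2 ^ 22 * A ^ 6)) ≤
      carlesonIntegral (μH[1].restrict K) 1 2 x δ := by
  have hρ := h.pos
  have hA : 0 < A := by linarith [h.one_le]
  have hinner : ∀ y ∈ graphMap f '' Icc a (a + 2 * ρ), ENNReal.ofReal (M / (2 ^ 22 * A ^ 6)) ≤
      ∫⁻ r in Ioo (0 : ℝ) δ, jonesBeta (μH[1].restrict K) 1 2 y r ^ 2 / ENNReal.ofReal r := by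
    intro y hy
    -- All of these scales see the whole comb.
    have hsub : Ioo (4 * A * ρ) (8 * A * ρ) ⊆ Ioo 0 δ :=
      Ioo_subset_Ioo (by positivity) hδ
    refine le_trans ?_ (lintegral_mono_set hsub)
    have hr : ∀ r ∈ Ioo (4 * A * ρ) (8 * A * ρ),
        ENNReal.ofReal (M * (ρ / (16 * A)) ^ 3 / (8 * A * ρ) ^ 4) ≤
          jonesBeta (μH[1].restrict K) 1 2 y r ^ 2 / ENNReal.ofReal r := by
      intro r hr
      have hr0 : 0 < r := lt_trans (by positivity) hr.1
      calc ENNReal.ofReal (M * (ρ / (16 * A)) ^ 3 / (8 * A * ρ) ^ 4)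
          ≤ ENNReal.ofReal (M * (ρ / (16 * A)) ^ 3 / r ^ 3 / r) := by
            rw [div_div, ← pow_succ]
            have := hr.2.le
            gcongr
        _ = ENNReal.ofReal (M * (ρ / (16 * A)) ^ 3 / r ^ 3) / ENNReal.ofReal r :=
            ENNReal.ofReal_div_of_pos hr0
        _ ≤ _ := by
            gcongr
            exact h.ofReal_le_jonesBeta_sq hf hK hy hr.1.le
    refine le_trans (le_of_eq ?_) (setLIntegral_mono' measurableSet_Ioo hr)
    rw [setLIntegral_const, Real.volume_Ioo, ← ENNReal.ofReal_mul (by positivity)]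
    congr 1
    field_simp
    ring
  unfold carlesonIntegral
  rw [Measure.restrict_restrict measurableSet_ball]
  refine le_trans ?_ (lintegral_mono_set (subset_inter hx hK))
  refine le_trans ?_ (setLIntegral_mono' (measurableSet_graphMap_image hf _ _) hinner)
  rw [setLIntegral_const, show (M : ℝ) ^ 2 * ρ / (2 ^ 22 * A ^ 6) =
    M / (2 ^ 22 * A ^ 6) * (M * ρ) by ring, ENNReal.ofReal_mul (by positivity)]
  gcongr
  exact h.ofReal_le_hausdorffMeasure hf

end IsComb

/-! ### Curves of finite length -/

section BoundedVariation

variable {γ : ℝ → EuclideanSpace ℝ (Fin 2)} {V : ℝ → ℝ}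

/-- Reparametrizing `γ` by `V` makes it `1`-Lipschitz. -/
lemma exists_lipschitzOnWith_comp_eq (hV : StrictMono V)
    (h : ∀ s t, s ≤ t → dist (γ s) (γ t) ≤ V t - V s) :
    ∃ g : ℝ → EuclideanSpace ℝ (Fin 2), LipschitzOnWith 1 g (V '' Icc 0 1) ∧ g ∘ V = γ := by
  have hinv : γ ∘ Function.invFun V ∘ V = γ := by
    funext t
    simp [Function.leftInverse_invFun hV.injective t]
  refine ⟨γ ∘ Function.invFun V, LipschitzOnWith.of_dist_le_mul ?_, hinv⟩
  rintro _ ⟨s, -, rfl⟩ _ ⟨t, -, rfl⟩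
  have e (u : ℝ) : (γ ∘ Function.invFun V) (V u) = γ u := congrFun hinv u
  rw [e, e, NNReal.coe_one, one_mul, Real.dist_eq]
  rcases le_total s t with hst | hst
  · rw [abs_sub_comm]
    exact (h s t hst).trans (le_abs_self _)
  · rw [dist_comm]
    exact (h t s hst).trans (le_abs_self _)

lemma eVariationOn_lt_top_of_dist_le (hV : StrictMono V)
    (h : ∀ s t, s ≤ t → dist (γ s) (γ t) ≤ V t - V s) : eVariationOn γ (Icc 0 1) < ∞ := by
  obtain ⟨g, hg, hgV⟩ := exists_lipschitzOnWith_comp_eq hV h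
  have h1 := hg.comp_eVariationOn_le (mapsTo_image V (Icc 0 1))
  have h2 := (hV.monotone.monotoneOn (Icc (0 : ℝ) 1)).eVariationOn_eq
    (left_mem_Icc.2 zero_le_one) (right_mem_Icc.2 zero_le_one)
  rw [inter_self] at h2
  rw [hgV, h2] at h1
  exact h1.trans_lt (by finiteness)

lemma hausdorffMeasure_image_lt_top_of_dist_le (hV : StrictMono V)
    (h : ∀ s t, s ≤ t → dist (γ s) (γ t) ≤ V t - V s) : μH[1] (γ '' Icc 0 1) < ∞ := by
  obtain ⟨g, hg, hgV⟩ := exists_lipschitzOnWith_comp_eq hV h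
  rw [← hgV, image_comp]
  have hsub : V '' Icc 0 1 ⊆ Icc (V 0) (V 1) := by
    rintro _ ⟨t, ht, rfl⟩
    exact ⟨hV.monotone ht.1, hV.monotone ht.2⟩
  calc μH[1] (g '' (V '' Icc 0 1)) ≤ μH[1] (V '' Icc 0 1) := by
        simpa using hg.hausdorffMeasure_image_le zero_le_one
    _ ≤ μH[1] (Icc (V 0) (V 1)) := measure_mono hsub
    _ < ∞ := by rw [hausdorffMeasure_real]; exact measure_Icc_lt_top

end BoundedVariation

/-! ### A series of combs -/

/-- The function that is `0` to the left of `a`, has slope `1` on `[a, a + 2 * ρ]`, and is constant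
to the right of `a + 2 * ρ`. -/
def ramp (a ρ t : ℝ) : ℝ := max 0 (min (t - a) (2 * ρ))

lemma ramp_nonneg (a ρ t : ℝ) : 0 ≤ ramp a ρ t := le_max_left _ _

lemma ramp_le {ρ : ℝ} (hρ : 0 ≤ ρ) (a t : ℝ) : ramp a ρ t ≤ 2 * ρ :=
  max_le (by linarith) (min_le_right _ _)

lemma ramp_mono (a ρ : ℝ) : Monotone (ramp a ρ) := fun s t h => by
  unfold ramp
  gcongr

lemma ramp_of_mem {a ρ t : ℝ} (h : t ∈ Icc a (a + 2 * ρ)) : ramp a ρ t = t - a := by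
  unfold ramp
  rw [min_eq_left (by linarith [h.2]), max_eq_right (by linarith [h.1])]

lemma continuous_ramp (a ρ : ℝ) : Continuous (ramp a ρ) := by
  unfold ramp
  fun_prop

lemma abs_ramp_sub_le (a ρ s t : ℝ) : |ramp a ρ s - ramp a ρ t| ≤ |s - t| := by
  unfold ramp
  calc _ ≤ |min (s - a) (2 * ρ) - min (t - a) (2 * ρ)| := by
        simpa using abs_max_sub_max_le_max 0 (min (s - a) (2 * ρ)) 0 (min (t - a) (2 * ρ))
    _ ≤ |s - t| := by
        simpa using abs_min_sub_min_le_max (s - a) (2 * ρ) (t - a) (2 * ρ)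

/-- One plus the sum of the numbers of teeth (halved) of the first `k` combs. -/
def combSum : ℕ → ℕ
  | 0 => 1
  | k + 1 => combSum k + 1000 * 4 ^ k * combSum k ^ 7

/-- Half the number of teeth of the `k`-th comb. -/
def combTeeth (k : ℕ) : ℕ := 1000 * 4 ^ k * combSum k ^ 7

/-- The amplitude of the `k`-th comb. It is also half of its width. -/
noncomputable def combAmp (k : ℕ) : ℝ := (1 / 2) ^ k / combTeeth k

lemma combSum_succ (k : ℕ) : combSum (k + 1) = combSum k + combTeeth k := rfl

lemma one_le_combSum (k : ℕ) : 1 ≤ combSum k := by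
  induction k with
  | zero => exact le_rfl
  | succ k ih => rw [combSum_succ]; omega

lemma one_le_combSum_real (k : ℕ) : (1 : ℝ) ≤ combSum k := by exact_mod_cast one_le_combSum k

lemma combSum_eq_sum (k : ℕ) :
    (combSum k : ℝ) = 1 + ∑ j ∈ Finset.range k, (combTeeth j : ℝ) := by
  induction k with
  | zero => simp [combSum]
  | succ k ih => rw [combSum_succ, Nat.cast_add, ih, Finset.sum_range_succ, add_assoc]

lemma combTeeth_real (k : ℕ) : (combTeeth k : ℝ) = 1000 * 4 ^ k * (combSum k : ℝ) ^ 7 := by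
  simp [combTeeth]

lemma mul_combSum_le_combTeeth (k : ℕ) : 1000 * (combSum k : ℝ) ≤ combTeeth k := by
  have h1 := one_le_combSum_real k
  have h2 : (1 : ℝ) ≤ 4 ^ k := one_le_pow₀ (by norm_num)
  have h3 : (combSum k : ℝ) ≤ (combSum k : ℝ) ^ 7 := le_self_pow₀ h1 (by norm_num)
  rw [combTeeth_real]
  nlinarith

lemma combTeeth_pos (k : ℕ) : (0 : ℝ) < combTeeth k := by
  linarith [one_le_combSum_real k, mul_combSum_le_combTeeth k]

lemma combAmp_pos (k : ℕ) : 0 < combAmp k := div_pos (by positivity) (combTeeth_pos k)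

lemma combTeeth_mul_combAmp (k : ℕ) : combTeeth k * combAmp k = (1 / 2) ^ k := by
  have := (combTeeth_pos k).ne'
  unfold combAmp
  field_simp

lemma combSum_mul_combAmp_le (k : ℕ) : 1000 * (combSum k * combAmp k) ≤ (1 / 2) ^ k := by
  rw [← combTeeth_mul_combAmp, ← mul_assoc]
  exact mul_le_mul_of_nonneg_right (mul_combSum_le_combTeeth k) (combAmp_pos k).le

lemma combAmp_le (k : ℕ) : combAmp k ≤ (1 / 2) ^ k := by
  nlinarith [combSum_mul_combAmp_le k, one_le_combSum_real k, combAmp_pos k]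

lemma summable_combAmp : Summable combAmp :=
  .of_nonneg_of_le (fun k => (combAmp_pos k).le) combAmp_le summable_geometric_two

lemma combAmp_succ_le (k : ℕ) : combAmp (k + 1) ≤ combAmp k / 16 := by
  have h1 : (1000 : ℝ) * combTeeth k ≤ combTeeth (k + 1) := by
    have := mul_combSum_le_combTeeth (k + 1)
    rw [combSum_succ] at this
    push_cast at this
    linarith [one_le_combSum_real k]
  have h2 := combTeeth_pos k
  unfold combAmp
  rw [div_div, pow_succ]
  refine div_le_div₀ (by positivity) (by nlinarith [pow_pos (one_half_pos (α := ℝ)) k])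
    (by positivity) (by linarith)

lemma combAmp_add_le (k j : ℕ) : combAmp (j + (k + 1)) ≤ combAmp k / 16 * (1 / 2) ^ j := by
  induction j with
  | zero => simpa using combAmp_succ_le k
  | succ j ih =>
    have h1 := combAmp_succ_le (j + (k + 1))
    have h2 := combAmp_pos (j + (k + 1))
    rw [show j + 1 + (k + 1) = j + (k + 1) + 1 by ring, pow_succ]
    linarith

/-- The `k`-th comb, placed on the interval `[a, a + 2 * combAmp k]`: a cosine with
`2 * combTeeth k` periods there, continued by constants. -/
noncomputable def combWave (a : ℝ) (k : ℕ) (t : ℝ) : ℝ :=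
  combAmp k * Real.cos (2 * combTeeth k / combAmp k * ramp a (combAmp k) t * Real.pi)

lemma continuous_combWave (a : ℝ) (k : ℕ) : Continuous (combWave a k) := by
  have := continuous_ramp a (combAmp k)
  unfold combWave
  fun_prop

lemma abs_combWave_le (a : ℝ) (k : ℕ) (t : ℝ) : |combWave a k t| ≤ combAmp k := by
  unfold combWave
  rw [abs_mul, abs_of_pos (combAmp_pos k)]
  exact mul_le_of_le_one_right (combAmp_pos k).le (Real.abs_cos_le_one _)

lemma abs_combWave_sub_le_ramp (a : ℝ) (k : ℕ) (s t : ℝ) :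
    |combWave a k s - combWave a k t| ≤
      7 * combTeeth k * |ramp a (combAmp k) s - ramp a (combAmp k) t| := by
  have hρ := combAmp_pos k
  have hM := combTeeth_pos k
  unfold combWave
  set p := ramp a (combAmp k) s
  set q := ramp a (combAmp k) t
  rw [← mul_sub, abs_mul, abs_of_pos hρ]
  calc _ ≤ combAmp k * |2 * combTeeth k / combAmp k * p * Real.pi
          - 2 * combTeeth k / combAmp k * q * Real.pi| := by
        exact mul_le_mul_of_nonneg_left (Real.abs_cos_sub_cos_le _ _) hρ.le
    _ = 2 * Real.pi * combTeeth k * |p - q| := by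
        rw [← sub_mul, ← mul_sub, abs_mul, abs_mul, abs_of_pos Real.pi_pos,
          abs_of_pos (by positivity : 0 < 2 * (combTeeth k : ℝ) / combAmp k)]
        field_simp
    _ ≤ 7 * combTeeth k * |p - q| := by
        gcongr
        linarith [Real.pi_lt_d2]

lemma combWave_of_nat {a : ℝ} {k n : ℕ} (hn : n ≤ 4 * combTeeth k) :
    combWave a k (a + n * (combAmp k / (2 * combTeeth k))) = combAmp k * (-1) ^ n := by
  have hρ := combAmp_pos k
  have hM := combTeeth_pos k
  have hn' : (n : ℝ) ≤ 4 * combTeeth k := by exact_mod_cast hn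
  have hmem : a + n * (combAmp k / (2 * combTeeth k)) ∈ Icc a (a + 2 * combAmp k) := by
    refine ⟨by linarith [show 0 ≤ n * (combAmp k / (2 * combTeeth k)) by positivity], ?_⟩
    have : n * (combAmp k / (2 * combTeeth k)) ≤
        4 * combTeeth k * (combAmp k / (2 * combTeeth k)) := by gcongr
    have h2 : 4 * combTeeth k * (combAmp k / (2 * combTeeth k)) = 2 * combAmp k := by
      field_simp
      norm_num
    linarith
  unfold combWave
  rw [ramp_of_mem hmem, show 2 * combTeeth k / combAmp k *
    (a + n * (combAmp k / (2 * combTeeth k)) - a) * Real.pi = n * Real.pi by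
      rw [add_sub_cancel_left]; field_simp, Real.cos_nat_mul_pi]

/-- The sum of all combs, the `k`-th one placed at `a k`. -/
noncomputable def combSeries (a : ℕ → ℝ) (t : ℝ) : ℝ := ∑' k, combWave (a k) k t

lemma summable_combWave (a : ℕ → ℝ) (t : ℝ) : Summable fun k => combWave (a k) k t :=
  .of_norm_bounded summable_combAmp fun k => abs_combWave_le (a k) k t

lemma continuous_combSeries (a : ℕ → ℝ) : Continuous (combSeries a) :=
  continuous_tsum (fun k => continuous_combWave (a k) k) summable_combAmp
    fun k t => abs_combWave_le (a k) k t

/-- An increasing function whose increments bound those of the graph of `combSeries a`. -/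
noncomputable def combLength (a : ℕ → ℝ) (t : ℝ) : ℝ :=
  t + ∑' k, 7 * combTeeth k * ramp (a k) (combAmp k) t

lemma summable_combLength (a : ℕ → ℝ) (t : ℝ) :
    Summable fun k => 7 * combTeeth k * ramp (a k) (combAmp k) t := by
  refine .of_nonneg_of_le (fun k => mul_nonneg (by positivity) (ramp_nonneg _ _ _)) (fun k => ?_)
    (summable_geometric_two.mul_left 14)
  have := ramp_le (combAmp_pos k).le (a k) t
  calc 7 * combTeeth k * ramp (a k) (combAmp k) t ≤ 7 * combTeeth k * (2 * combAmp k) := by gcongr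
    _ = 14 * (1 / 2) ^ k := by rw [← combTeeth_mul_combAmp]; ring

lemma add_abs_combSeries_sub_le (a : ℕ → ℝ) {s t : ℝ} (hst : s ≤ t) :
    |s - t| + |combSeries a s - combSeries a t| ≤ combLength a t - combLength a s := by
  have h1 := ((summable_combLength a t).hasSum.sub (summable_combLength a s).hasSum)
  have h2 := tsum_of_norm_bounded (f := fun k => combWave (a k) k s - combWave (a k) k t) h1
    fun k => by
      refine (abs_combWave_sub_le_ramp (a k) k s t).trans (le_of_eq ?_)
      rw [abs_sub_comm, abs_of_nonneg (sub_nonneg.2 (ramp_mono _ _ hst)), mul_sub]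
  rw [(summable_combWave a s).tsum_sub (summable_combWave a t), Real.norm_eq_abs] at h2
  rw [abs_sub_comm s t, abs_of_nonneg (sub_nonneg.2 hst)]
  unfold combLength combSeries
  linarith

lemma combLength_strictMono (a : ℕ → ℝ) : StrictMono (combLength a) := fun s t hst => by
  have h1 := add_abs_combSeries_sub_le a hst.le
  have h2 : 0 < |s - t| := abs_pos.2 (sub_ne_zero.2 hst.ne)
  linarith [abs_nonneg (combSeries a s - combSeries a t)]

lemma dist_graphMap_combSeries_le (a : ℕ → ℝ) (s t : ℝ) (hst : s ≤ t) :
    dist (graphMap (combSeries a) s) (graphMap (combSeries a) t) ≤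
      combLength a t - combLength a s :=
  (dist_graphMap_le _ s t).trans (add_abs_combSeries_sub_le a hst)

lemma abs_tsum_combWave_add_le (a : ℕ → ℝ) (k : ℕ) (t : ℝ) :
    |∑' j, combWave (a (j + (k + 1))) (j + (k + 1)) t| ≤ combAmp k / 8 := by
  have h := hasSum_geometric_two.mul_left (combAmp k / 16)
  rw [show combAmp k / 16 * 2 = combAmp k / 8 by ring] at h
  exact tsum_of_norm_bounded (f := fun j => combWave (a (j + (k + 1))) (j + (k + 1)) t) h
    fun j => (abs_combWave_le _ _ t).trans (combAmp_add_le k j)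

/-- The `k`-th comb dominates at its own scale: the earlier combs have a moderate Lipschitz
constant, and the later ones a small amplitude. -/
lemma abs_combSeries_sub_sub_combWave_sub_le (a : ℕ → ℝ) (k : ℕ) (s t : ℝ) :
    |(combSeries a s - combSeries a t) - (combWave (a k) k s - combWave (a k) k t)| ≤
      7 * (combSum k - 1) * |s - t| + combAmp k / 4 := by
  have hsplit (u : ℝ) : combSeries a u = (∑ j ∈ Finset.range k, combWave (a j) j u) +
      combWave (a k) k u + ∑' j, combWave (a (j + (k + 1))) (j + (k + 1)) u := by
    rw [← Finset.sum_range_succ, combSeries, (summable_combWave a u).sum_add_tsum_nat_add]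
  have hhead : |(∑ j ∈ Finset.range k, combWave (a j) j s) -
      ∑ j ∈ Finset.range k, combWave (a j) j t| ≤ 7 * (combSum k - 1) * |s - t| := by
    rw [← Finset.sum_sub_distrib, combSum_eq_sum, add_sub_cancel_left, Finset.mul_sum,
      Finset.sum_mul]
    refine (Finset.abs_sum_le_sum_abs _ _).trans (Finset.sum_le_sum fun j _ => ?_)
    refine (abs_combWave_sub_le_ramp (a j) j s t).trans ?_
    exact mul_le_mul_of_nonneg_left (abs_ramp_sub_le _ _ _ _) (by positivity)
  have hs := abs_tsum_combWave_add_le a k s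
  have ht := abs_tsum_combWave_add_le a k t
  rw [hsplit s, hsplit t]
  rw [abs_le] at hhead hs ht ⊢
  constructor <;> linarith [hhead.1, hhead.2, hs.1, hs.2, ht.1, ht.2]

lemma isComb_combSeries (a : ℕ → ℝ) (k : ℕ) :
    IsComb (combSeries a) (a k) (combAmp k) (combTeeth k) (16 * combSum k) := by
  have hρ := combAmp_pos k
  have hM := combTeeth_pos k
  have hA := one_le_combSum_real k
  have hMA := mul_combSum_le_combTeeth k
  refine ⟨hρ, by linarith, by linarith, fun i hi => ?_, fun s hs t ht => ?_⟩
  · have h := abs_combSeries_sub_sub_combWave_sub_le a k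
      (a k + (2 * i + 1) * (combAmp k / (2 * combTeeth k)))
      (a k + 2 * i * (combAmp k / (2 * combTeeth k)))
    have e1 := combWave_of_nat (a := a k) (k := k) (n := 2 * i + 1) (by omega)
    have e2 := combWave_of_nat (a := a k) (k := k) (n := 2 * i) (by omega)
    -- The comb goes from its maximum to its minimum along a tooth.
    rw [Odd.neg_one_pow ⟨i, rfl⟩] at e1
    rw [Even.neg_one_pow ⟨i, two_mul i⟩] at e2
    push_cast at e1 e2
    rw [e1, e2] at h
    set σ := combAmp k / (2 * combTeeth k) with hσ
    have hσ0 : 0 < σ := by positivity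
    rw [show a k + (2 * i + 1) * σ - (a k + 2 * i * σ) = σ by ring, abs_of_pos hσ0] at h
    have hσM : combTeeth k * σ = combAmp k / 2 := by rw [hσ]; field_simp
    have h7 : 7 * ((combSum k : ℝ) - 1) * σ ≤ combAmp k / 4 := by nlinarith
    rw [abs_le] at h
    rw [le_abs']
    left
    linarith [h.2]
  · have h := abs_combSeries_sub_sub_combWave_sub_le a k s t
    have h1 := abs_combWave_le (a k) k s
    have h2 := abs_combWave_le (a k) k t
    have h3 : |s - t| ≤ 2 * combAmp k :=
      abs_le.2 ⟨by linarith [hs.1, ht.2], by linarith [hs.2, ht.1]⟩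
    have h4 : 7 * ((combSum k : ℝ) - 1) * |s - t| ≤ 7 * (combSum k - 1) * (2 * combAmp k) := by
      have : (0 : ℝ) ≤ combSum k - 1 := by linarith
      gcongr
    have h5 : combAmp k ≤ combSum k * combAmp k := le_mul_of_one_le_left hρ.le hA
    rw [abs_le] at h h1 h2 ⊢
    constructor <;> nlinarith [h.1, h.2, h1.1, h1.2, h2.1, h2.2]

/-- The Carleson integral near the `k`-th comb is at least of order `2 ^ k`. -/
lemma two_pow_le_combTeeth_sq_mul (k : ℕ) :
    (2 : ℝ) ^ k / 2 ^ 46 ≤ combTeeth k ^ 2 * combAmp k / (2 ^ 22 * (16 * combSum k) ^ 6) := by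
  have hA := one_le_combSum_real k
  have e : (combTeeth k : ℝ) ^ 2 * combAmp k = 1000 * 2 ^ k * (combSum k : ℝ) ^ 7 := by
    rw [pow_two, mul_assoc, combTeeth_mul_combAmp, combTeeth_real,
      show (4 : ℝ) ^ k = 2 ^ k * 2 ^ k by rw [← mul_pow]; norm_num]
    have : (2 : ℝ) ^ k * (1 / 2) ^ k = 1 := by rw [← mul_pow]; norm_num
    linear_combination 1000 * 2 ^ k * (combSum k : ℝ) ^ 7 * this
  rw [e, div_le_div_iff₀ (by positivity) (by positivity)]
  have h7 : (combSum k : ℝ) ^ 6 ≤ 1000 * (combSum k : ℝ) ^ 7 := by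
    have := pow_le_pow_right₀ hA (show 6 ≤ 7 by norm_num)
    linarith [pow_pos (zero_lt_one.trans_le hA) 7]
  calc (2 : ℝ) ^ k * (2 ^ 22 * (16 * combSum k) ^ 6)
      = 2 ^ k * (combSum k : ℝ) ^ 6 * 2 ^ 46 := by ring
    _ ≤ 2 ^ k * (1000 * (combSum k : ℝ) ^ 7) * 2 ^ 46 := by gcongr
    _ = _ := by ring

/-! ### Combs along a dense sequence -/

lemma exists_ge_denseSeq_mem {U : Set ℝ} (hU : IsOpen U) (hne : U.Nonempty) (n : ℕ) :
    ∃ k ≥ n, TopologicalSpace.denseSeq ℝ k ∈ U := by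
  have hd : Dense (range (TopologicalSpace.denseSeq ℝ) \
      (TopologicalSpace.denseSeq ℝ '' Iio n)) :=
    (TopologicalSpace.denseRange_denseSeq ℝ).sdiff_finite ((finite_Iio n).image _)
  obtain ⟨_, hxU, ⟨k, rfl⟩, hk⟩ := hd.inter_open_nonempty U hU hne
  exact ⟨k, not_lt.1 fun h => hk ⟨k, h, rfl⟩, hxU⟩

/-- Every neighbourhood of a point of the graph contains combs of arbitrarily high index. -/
lemma carlesonIntegral_combSeries_eq_top {x : EuclideanSpace ℝ (Fin 2)}
    (hx : x ∈ graphMap (combSeries (TopologicalSpace.denseSeq ℝ)) '' Icc 0 1) {δ : ℝ}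
    (hδ : 0 < δ) :
    carlesonIntegral
      (μH[1].restrict (graphMap (combSeries (TopologicalSpace.denseSeq ℝ)) '' Icc 0 1))
      1 2 x δ = ∞ := by
  set a := TopologicalSpace.denseSeq ℝ
  obtain ⟨t₀, ht₀, rfl⟩ := hx
  have hf := continuous_combSeries a
  set U := graphMap (combSeries a) ⁻¹' ball (graphMap (combSeries a) t₀) δ ∩ Ioo 0 1 with hU
  have hVopen := (isOpen_ball (x := graphMap (combSeries a) t₀) (ε := δ)).preimage
    (continuous_graphMap hf)
  have hUopen : IsOpen U := hVopen.inter isOpen_Ioo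
  have hUne : U.Nonempty := by
    rw [← closure_Ioo zero_ne_one] at ht₀
    exact mem_closure_iff.1 ht₀ _ hVopen (mem_ball_self hδ)
  obtain ⟨p, hp⟩ := hUne
  obtain ⟨η, hη, hηU⟩ := Metric.isOpen_iff.1 hUopen p hp
  refine ENNReal.eq_top_of_forall_nnreal_le fun C => ?_
  have hlim : Filter.Tendsto (fun k : ℕ => (1 / 2 : ℝ) ^ k) Filter.atTop (nhds 0) :=
    tendsto_pow_atTop_nhds_zero_of_lt_one (by norm_num) (by norm_num)
  have hlim2 : Filter.Tendsto (fun k : ℕ => (2 : ℝ) ^ k) Filter.atTop Filter.atTop :=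
    tendsto_pow_atTop_atTop_of_one_lt (by norm_num)
  obtain ⟨n, hn⟩ := Filter.eventually_atTop.1
    ((hlim.eventually_lt_const (by positivity : 0 < η / 4)).and
      ((hlim.eventually_lt_const hδ).and (hlim2.eventually_ge_atTop (C * 2 ^ 46))))
  obtain ⟨k, hk, hak⟩ :=
    exists_ge_denseSeq_mem (isOpen_ball (x := p) (ε := η / 2)) ⟨p, mem_ball_self (by positivity)⟩ n
  obtain ⟨h1, h2, h3⟩ := hn k hk
  have hsub : Icc (a k) (a k + 2 * combAmp k) ⊆ U := by
    intro t ht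
    refine hηU ?_
    have := combAmp_le k
    rw [mem_ball, Real.dist_eq, abs_lt] at hak ⊢
    constructor <;> linarith [ht.1, ht.2, hak.1, hak.2]
  have hK : graphMap (combSeries a) '' Icc (a k) (a k + 2 * combAmp k) ⊆
      graphMap (combSeries a) '' Icc 0 1 :=
    image_mono fun t ht => Ioo_subset_Icc_self (hsub ht).2
  have hball : graphMap (combSeries a) '' Icc (a k) (a k + 2 * combAmp k) ⊆
      ball (graphMap (combSeries a) t₀) δ := by
    rintro _ ⟨t, ht, rfl⟩
    exact (hsub ht).1
  refine le_trans ?_ ((isComb_combSeries a k).ofReal_le_carlesonIntegral hf hK hball ?_)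
  · rw [← ENNReal.ofReal_coe_nnreal]
    refine ENNReal.ofReal_le_ofReal (le_trans ?_ (two_pow_le_combTeeth_sq_mul k))
    rwa [le_div_iff₀ (by positivity)]
  · have h4 := combSum_mul_combAmp_le k
    have h5 : 0 < combSum k * combAmp k :=
      mul_pos (by linarith [one_le_combSum_real k]) (combAmp_pos k)
    linarith

theorem theorem1p1 :
    ∃ K₀ : Set (EuclideanSpace ℝ (Fin 2)),
      IsRectifiableCurve K₀ ∧ IsConnected K₀ ∧
      0 < μH[1] K₀ ∧ μH[1] K₀ < ∞ ∧
      ∀ x ∈ K₀, ∀ δ : ℝ, 0 < δ →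
        carlesonIntegral (μH[1].restrict K₀) 1 2 x δ = ∞ := by
  set a := TopologicalSpace.denseSeq ℝ
  have hγ := continuous_graphMap (continuous_combSeries a)
  have hV := combLength_strictMono a
  have hd := dist_graphMap_combSeries_le a
  refine ⟨graphMap (combSeries a) '' Icc 0 1,
    ⟨graphMap (combSeries a), hγ.continuousOn, eVariationOn_lt_top_of_dist_le hV hd, rfl⟩,
    (isConnected_Icc zero_le_one).image _ hγ.continuousOn, ?_,
    hausdorffMeasure_image_lt_top_of_dist_le hV hd,
    fun x hx δ hδ => carlesonIntegral_combSeries_eq_top hx hδ⟩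
  have h : ENNReal.ofReal |(1 : ℝ) - 0| ≤ μH[1] (graphMap (combSeries a) '' Icc 0 1) := by
    refine ofReal_abs_sub_le_hausdorffMeasure (lipschitzWith_apply 0) ?_
    rw [image_image, uIcc_of_le zero_le_one]
    simp
  exact lt_of_lt_of_le (by simp) h
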